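/- Let $G=(S,T,E)$ be a finite bipartite graph with vertex set $V=S\cup T$ (with $S\cap T=\emptyset$ and every edge joining $S$ to $T$). For a matching $M$ of $G$ let $V(M)$ be the set of vertices covered by $M$, and let $B(M)=V(M)\,\Delta\, S$, where $\Delta$ denotes symmetric difference. Let $M$ be chosen uniformly at random among all matchings of $G$ with the maximum number of edges. Then the random subset $B(M)$ of $V$ satisfies the BK inequality for increasing events: for all families $\mathcal{A},\mathcal{B}\subseteq 2^V$ that are upward closed under inclusion, \[\mathbb{P}\bigl(B(M)\in \mathcal{A}\,\square\, \mathcal{B}\bigr)\le \mathbb{P}\bigl(B(M)\in\mathcal{A}\bigr)\,\mathbb{P}\bigl(B(M)\in\mathcal{B}\bigr),\] where $\mathcal{A}\,\square\,\mathcal{B}=\{A\cup B : A\in\mathcal{A},\ B\in\mathcal{B},\ A\cap B=\emptyset\}$. -/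

import Mathlib

namespace BKMatching

open SimpleGraph
open scoped symmDiff

/-- The maximum size matchings of `G`: matchings (identified with subgraphs in which each vertex
has exactly one neighbour) such that no matching of `G` has more edges. -/
def maximumMatchings {V : Type*} (G : SimpleGraph V) : Set G.Subgraph :=
  {M | M.IsMatching ∧ ∀ N : G.Subgraph, N.IsMatching → N.edgeSet.ncard ≤ M.edgeSet.ncard}

theorem maximumMatchings_nonempty {V : Type*} [Finite V] (G : SimpleGraph V) :
    (maximumMatchings G).Nonempty := by
  obtain ⟨M, hM, hmax⟩ := Set.exists_max_image {M : G.Subgraph | M.IsMatching}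
    (fun M => M.edgeSet.ncard) (Set.toFinite _) ⟨⊥, fun v hv => absurd hv (by simp)⟩
  exact ⟨M, hM, fun N hN => hmax N hN⟩

/-- The uniform distribution on the maximum size matchings of `G`. -/
noncomputable def uniformMaximumMatching {V : Type*} [Finite V] (G : SimpleGraph V) :
    PMF G.Subgraph :=
  PMF.uniformOfFinset (Set.toFinite (maximumMatchings G)).toFinset
    ((Set.Finite.toFinset_nonempty _).mpr (maximumMatchings_nonempty G))

/-- `B(M) = V(M) ∆ S`, where `V(M)` is the set of vertices covered by the matching `M`. -/
def coveredSymmDiff {V : Type*} {G : SimpleGraph V} (S : Set V) (M : G.Subgraph) : Set V :=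
  M.verts ∆ S

/-- Disjoint occurrence `𝒜 □ ℬ` of two (increasing) events. -/
def disjointOccurrence {V : Type*} (𝒜 ℬ : Set (Set V)) : Set (Set V) :=
  {C | ∃ A ∈ 𝒜, ∃ B ∈ ℬ, A ∩ B = ∅ ∧ C = A ∪ B}

/-- A random subset of `V` with law `μ` satisfies the BK inequality for increasing events.
Here `μ.toOuterMeasure 𝒜` is the probability of the event `𝒜`. -/
def SatisfiesBKIncreasing {V : Type*} (μ : PMF (Set V)) : Prop :=
  ∀ 𝒜 ℬ : Set (Set V), IsUpperSet 𝒜 → IsUpperSet ℬ →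
    μ.toOuterMeasure (disjointOccurrence 𝒜 ℬ) ≤ μ.toOuterMeasure 𝒜 * μ.toOuterMeasure ℬ

end BKMatching

namespace BKMatching

open Finset

/-! ### Reimer's inequality on the discrete cube -/

/-! Take two independent uniform maximum matchings `σ`, `τ`, encoded as involutions. Exchanging them
on any set of components of their union again gives two maximum matchings with the same union, so
for fixed union and components the choice `ω` of exchanges is a uniform point of a discrete cube.

In each component, at most one vertex lies in `B(σ)` but not in `B(τ)`, and at most one the other
way round (`IsMaximumInvolution.eq_of_mem_movedSymmDiff`). Hence disjoint subsets of `B` of the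
mixed matching depend on disjoint sets of components, and disjoint occurrence in `V` becomes
disjoint occurrence in the cube. Reimer's inequality (`reimer`) bounds it by the event that `𝒜`
holds at `ω` and `ℬ` at the complement of `ω`; complementing interchanges the two mixed matchings
(`mix_not`). Averaging over pairs gives the product of the probabilities.

Reimer's inequality follows from the butterfly theorem (`card_le_of_butterflies`), proved by linear
algebra: tensors that are independent modulo two, and a Parseval identity whose terms outside `Z`
vanish. -/

/-- Four vectors of the plane, two orthogonal bases indexed by the first argument;
the last argument is the coordinate. -/
def reimerVec : Bool → Bool → Bool → ℤ
  | false, true, j => if j then 0 else 1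
  | false, false, j => if j then 1 else 0
  | true, true, _ => 1
  | true, false, j => if j then -1 else 1

/-- The `z`-th coordinate of the vector `(p, q)` in the basis `(1, 0), (1, 1)`, evaluated at
`reimerVec x s`. -/
def reimerCoord (z x s : Bool) : ℤ := ∑ j, reimerVec (!z) false j * reimerVec x s j

/-- The inner product of `reimerVec z true` and `reimerVec x s`. -/
def reimerDual (z x s : Bool) : ℤ := ∑ j, reimerVec z true j * reimerVec x s j

/-- Expand the first vector in the basis `(1, 0), (1, 1)`, whose members are the vectors `reimerVec
z true`, and pair with the second. -/
theorem sum_reimerVec_mul (x s x' s' : Bool) :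
    ∑ j, reimerVec x s j * reimerVec x' s' j = ∑ z, reimerCoord z x s * reimerDual z x' s' := by
  revert x s x' s'; decide

theorem reimerCoord_eq_zero {z x : Bool} (h : z ≠ x) : reimerCoord z x true = 0 := by
  revert z x; decide

theorem reimerDual_eq_zero (x : Bool) : reimerDual x x false = 0 := by
  revert x; decide

/-- The tensor product of the vectors `reimerVec (x i) (s i)`. -/
def reimerTensor {n : ℕ} (x s y : Fin n → Bool) : ℤ := ∏ i, reimerVec (x i) (s i) (y i)

theorem sum_fun_fin_succ_bool {n : ℕ} {M : Type*} [AddCommMonoid M] (f : (Fin (n + 1) → Bool) → M) :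
    ∑ x, f x = ∑ x, f (Fin.cons false x) + ∑ x, f (Fin.cons true x) := by
  rw [← (Fin.consEquiv fun _ => Bool).sum_comp, Fintype.sum_prod_type]
  simp [Fin.consEquiv, add_comm]

theorem reimerTensor_cons {n : ℕ} (a b : Bool) (x y : Fin n → Bool) (s : Fin (n + 1) → Bool) :
    reimerTensor (Fin.cons a x) s (Fin.cons b y) =
      reimerVec a (s 0) b * reimerTensor x (fun i => s i.succ) y := by
  simp [reimerTensor, Fin.prod_univ_succ]

/-- Modulo two, `(1, 1)` and `(1, -1)` coincide, while both standard basis vectors have coordinate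
sum 1. So independence will not depend on the choice of `s`. -/
theorem reimerVec_false_add (s : Bool) :
    ((reimerVec false s false : ℤ) : ZMod 2) + (reimerVec false s true : ZMod 2) = 1 := by
  cases s <;> simp [reimerVec]

theorem reimerVec_true_cast (s j : Bool) : ((reimerVec true s j : ℤ) : ZMod 2) = 1 := by
  cases s <;> cases j <;> simp [reimerVec]

/-- The tensors `reimerTensor x (S x)` are linearly independent modulo two. -/
theorem reimerTensor_independent_zmod_two {n : ℕ} (S : (Fin n → Bool) → Fin n → Bool)
    (c : (Fin n → Bool) → ZMod 2)
    (h : ∀ y, ∑ x, c x * (reimerTensor x (S x) y : ZMod 2) = 0) : c = 0 := by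
  induction n with
  | zero =>
    funext x
    have := h x
    rw [Fintype.sum_eq_single x fun b hb => absurd (Subsingleton.elim b x) hb] at this
    simpa [reimerTensor] using this
  | succ n ih =>
    have key : ∀ b y, ∑ x, c (Fin.cons false x) * (reimerVec false (S (Fin.cons false x) 0) b *
          (reimerTensor x (fun i => S (Fin.cons false x) i.succ) y : ZMod 2)) +
        ∑ x, c (Fin.cons true x) *
          (reimerTensor x (fun i => S (Fin.cons true x) i.succ) y : ZMod 2) = 0 := by
      intro b y
      have := h (Fin.cons b y)
      rw [sum_fun_fin_succ_bool] at this
      simpa only [reimerTensor_cons, Int.cast_mul, reimerVec_true_cast, one_mul] using this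
    have h0 : (fun x => c (Fin.cons false x)) = 0 := by
      refine ih (fun x i => S (Fin.cons false x) i.succ) _ fun y => ?_
      -- The second sum in `key` does not involve `b`, so adding the two slices cancels it in
      -- characteristic two.
      have e := congrArg₂ (· + ·) (key false y) (key true y)
      simp only [add_zero] at e
      rw [add_add_add_comm, CharTwo.add_self_eq_zero, add_zero, ← sum_add_distrib] at e
      rw [← e]
      refine sum_congr rfl fun x _ => ?_
      rw [← mul_add, ← add_mul, reimerVec_false_add, one_mul]
    have h1 : (fun x => c (Fin.cons true x)) = 0 := by
      refine ih (fun x i => S (Fin.cons true x) i.succ) _ fun y => ?_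
      have e := key false y
      have h0' : ∀ x, c (Fin.cons false x) = 0 := fun x => congrFun h0 x
      simpa [h0'] using e
    funext x
    rw [← Fin.cons_self_tail x]
    cases x 0
    · exact congrFun h0 _
    · exact congrFun h1 _

/-- The tensors `reimerTensor x (S x)` are linearly independent over the rationals. -/
theorem reimerTensor_independent {n : ℕ} (S : (Fin n → Bool) → Fin n → Bool)
    (c : (Fin n → Bool) → ℚ)
    (h : ∀ y, ∑ x, c x * (reimerTensor x (S x) y : ℚ) = 0) : c = 0 := by
  let A : Matrix (Fin n → Bool) (Fin n → Bool) ℤ := Matrix.of fun x y => reimerTensor x (S x) y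
  -- Independence modulo two makes the integer determinant odd, hence nonzero over `ℚ`.
  have hA2 : (A.map (Int.cast : ℤ → ZMod 2)).det ≠ 0 := by
    intro h0
    obtain ⟨v, hv, hv0⟩ := Matrix.exists_vecMul_eq_zero_iff.mpr h0
    exact hv (reimerTensor_independent_zmod_two S v fun y => congrFun hv0 y)
  have hA : A.det ≠ 0 := by
    intro h0
    apply hA2
    have := (Int.castRingHom (ZMod 2)).map_det A
    rw [h0, map_zero] at this
    exact this.symm
  have hAQ : (A.map (Int.cast : ℤ → ℚ)).det ≠ 0 := by
    have := (Int.castRingHom ℚ).map_det A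
    intro h0
    apply hA
    exact Int.cast_injective (α := ℚ) (by simpa using this.trans h0)
  exact Matrix.eq_zero_of_vecMul_eq_zero hAQ (funext h)

/-- Parseval's identity for the pair of dual bases. -/
theorem sum_reimerTensor_mul {n : ℕ} (x s x' s' : Fin n → Bool) :
    ∑ y, reimerTensor x s y * reimerTensor x' s' y =
      ∑ z : Fin n → Bool, (∏ i, reimerCoord (z i) (x i) (s i)) *
        ∏ i, reimerDual (z i) (x' i) (s' i) := by
  simp only [reimerTensor, ← prod_mul_distrib]
  have e (f : Fin n → Bool → ℤ) : ∑ y : Fin n → Bool, ∏ i, f i (y i) = ∏ i, ∑ j, f i j := by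
    rw [prod_univ_sum, Fintype.piFinset_univ]
  rw [e fun i j => reimerVec (x i) (s i) j * reimerVec (x' i) (s' i) j,
    e fun i z => reimerCoord z (x i) (s i) * reimerDual z (x' i) (s' i)]
  exact prod_congr rfl fun i _ => sum_reimerVec_mul _ _ _ _

/-- Reimer's butterfly theorem: `S x` is the set of coordinates fixed by the first wing of the
butterfly with body `x`. -/
theorem card_le_of_butterflies {n : ℕ} (X Z : Finset (Fin n → Bool))
    (S : (Fin n → Bool) → Fin n → Bool)
    (hZ : ∀ z, ∀ x ∈ X, ∀ x' ∈ X, (∀ i, S x i = true → z i = x i) →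
      (∀ i, S x' i = false → z i = !x' i) → z ∈ Z) :
    #X ≤ #Z := by
  by_contra! hlt
  let L : (X → ℚ) →ₗ[ℚ] (Z → ℚ) := Matrix.mulVecLin
    (Matrix.of fun (z : Z) (x : X) => (∏ i, (reimerCoord (z.1 i) (x.1 i) (S x.1 i) : ℚ)))
  -- With more unknowns than equations, some nontrivial combination of the tensors has zero
  -- coordinate at every `z ∈ Z`.
  have hker : LinearMap.ker L ≠ ⊥ := LinearMap.ker_ne_bot_of_finrank_lt (by simpa using hlt)
  obtain ⟨c, hc, hc0⟩ := Submodule.exists_mem_ne_zero_of_ne_bot hker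
  let d : (Fin n → Bool) → ℚ := fun x => if h : x ∈ X then c ⟨x, h⟩ else 0
  have hdX : ∀ x, x ∉ X → d x = 0 := fun x hx => by simp [d, hx]
  have hd : ∀ z ∈ Z, ∑ x, d x * ∏ i, (reimerCoord (z i) (x i) (S x i) : ℚ) = 0 := by
    intro z hz
    have := congrFun (LinearMap.mem_ker.mp hc) ⟨z, hz⟩
    rw [← sum_subset (subset_univ X) fun x _ hx => by rw [hdX x hx, zero_mul],
      ← sum_coe_sort X]
    simpa [L, Matrix.mulVec, dotProduct, d, mul_comm] using this
  have hsq : ∑ y, (∑ x, d x * (reimerTensor x (S x) y : ℚ)) ^ 2 = 0 := by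
    have e : ∑ y, (∑ x, d x * (reimerTensor x (S x) y : ℚ)) ^ 2 =
        ∑ z : Fin n → Bool, (∑ x, d x * ∏ i, (reimerCoord (z i) (x i) (S x i) : ℚ)) *
          ∑ x, d x * ∏ i, (reimerDual (z i) (x i) (S x i) : ℚ) := by
      simp only [sq, sum_mul_sum]
      rw [sum_comm]
      conv_rhs => rw [sum_comm]
      refine sum_congr rfl fun x _ => ?_
      rw [sum_comm]
      conv_rhs => rw [sum_comm]
      refine sum_congr rfl fun x' _ => ?_
      have h := congrArg (fun k : ℤ => d x * d x' * (k : ℚ))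
        (sum_reimerTensor_mul x (S x) x' (S x'))
      push_cast [mul_sum] at h
      exact (sum_congr rfl fun y _ => mul_mul_mul_comm _ _ _ _).trans
        (h.trans (sum_congr rfl fun z _ => mul_mul_mul_comm _ _ _ _))
    rw [e]
    refine sum_eq_zero fun z _ => ?_
    -- For `z ∉ Z`, a nonzero term would place `z` in the first wing at some `x ∈ X` and the second
    -- wing at some `x' ∈ X`, so `hZ` would give `z ∈ Z`.
    by_cases hz : z ∈ Z
    · rw [hd z hz, zero_mul]
    by_contra hne
    obtain ⟨h1, h2⟩ := mul_ne_zero_iff.mp hne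
    obtain ⟨x, -, hx⟩ := exists_ne_zero_of_sum_ne_zero h1
    obtain ⟨x', -, hx'⟩ := exists_ne_zero_of_sum_ne_zero h2
    obtain ⟨hx1, hx2⟩ := mul_ne_zero_iff.mp hx
    obtain ⟨hx1', hx2'⟩ := mul_ne_zero_iff.mp hx'
    refine hz (hZ z x (by_contra fun h => hx1 (hdX x h)) x' (by_contra fun h => hx1' (hdX x' h))
      (fun i hi => ?_) fun i hi => ?_)
    · by_contra hzi
      refine prod_ne_zero_iff.mp hx2 i (mem_univ i) ?_
      rw [hi, reimerCoord_eq_zero hzi, Int.cast_zero]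
    · by_contra hzi
      refine prod_ne_zero_iff.mp hx2' i (mem_univ i) ?_
      have : z i = x' i := by revert hzi; cases z i <;> cases x' i <;> simp
      rw [hi, this, reimerDual_eq_zero, Int.cast_zero]
  have hd0 : d = 0 := by
    refine reimerTensor_independent S d fun y => ?_
    have := (sum_eq_zero_iff_of_nonneg fun y _ => sq_nonneg _).mp hsq y (mem_univ y)
    exact pow_eq_zero_iff two_ne_zero |>.mp this
  apply hc0
  funext x
  have := congrFun hd0 x.1
  simpa [d] using this

open Classical in
/-- **Reimer's inequality**: the number of configurations in which `P` and `Q` occur disjointly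
is at most the number of configurations in `P` whose complement is in `Q`. -/
theorem reimer {n : ℕ} (P Q D : (Fin n → Bool) → Prop)
    (hD : ∀ x, D x → ∃ I J : Set (Fin n), Disjoint I J ∧
      (∀ y, (∀ i ∈ I, y i = x i) → P y) ∧ ∀ y, (∀ i ∈ J, y i = x i) → Q y) :
    #{x | D x} ≤ #{x | P x ∧ Q fun i => !x i} := by
  -- The first wing fixes the coordinates in `I x`; the second fixes the rest, which contain `J x`.
  choose! I J hIJ hP hQ using hD
  refine card_le_of_butterflies _ _ (fun x i => decide (i ∈ I x)) fun z x hx x' hx' h h' => ?_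
  simp only [mem_filter, mem_univ, true_and, decide_eq_true_eq, decide_eq_false_iff_not]
    at hx hx' h h' ⊢
  refine ⟨hP x hx z h, hQ x' hx' _ fun i hi => ?_⟩
  rw [h' i fun hi' => Set.disjoint_left.mp (hIJ x' hx') hi' hi, Bool.not_not]

/-! ### Matchings as involutions -/

section Involutions

variable {V : Type*}

/-- An involution that moves vertices only along edges of `G`, that is, a matching of `G`. -/
structure IsMatchingInvolution (G : SimpleGraph V) (σ : V → V) : Prop where
  involutive : Function.Involutive σ
  adj : ∀ v, σ v ≠ v → G.Adj v (σ v)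

/-- Apply `σ` at the vertices whose label is selected by `ω`, and `τ` elsewhere. -/
def mix {κ : Type*} (r : V → κ) (ω : κ → Bool) (σ τ : V → V) (v : V) : V :=
  if ω (r v) then σ v else τ v

theorem IsMatchingInvolution.mix {G : SimpleGraph V} {σ τ : V → V} {κ : Type*} {r : V → κ}
    (hσ : IsMatchingInvolution G σ) (hτ : IsMatchingInvolution G τ)
    (hrσ : ∀ v, r (σ v) = r v) (hrτ : ∀ v, r (τ v) = r v) (ω : κ → Bool) :
    IsMatchingInvolution G (mix r ω σ τ) where
  involutive v := by
    by_cases h : ω (r v) = true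
    · simp [BKMatching.mix, h, hrσ, hσ.involutive v]
    · simp [BKMatching.mix, h, hrτ, hτ.involutive v]
  adj v := by
    by_cases h : ω (r v) = true
    · simpa [BKMatching.mix, h] using hσ.adj v
    · simpa [BKMatching.mix, h] using hτ.adj v

theorem mix_not {κ : Type*} (r : V → κ) (ω : κ → Bool) (σ τ : V → V) :
    mix r (fun k => !ω k) σ τ = mix r ω τ σ := by
  funext v
  by_cases h : ω (r v) = true <;> simp [mix, h]

theorem mix_mix {κ : Type*} (r : V → κ) (ω : κ → Bool) (σ τ : V → V) :
    mix r ω (mix r ω σ τ) (mix r ω τ σ) = σ := by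
  funext v
  by_cases h : ω (r v) = true <;> simp [mix, h]

/-- The set `V(M) ∆ S` of the matching given by `σ`. -/
def movedSymmDiff (S : Set V) (σ : V → V) : Set V := {v | σ v = v ↔ v ∈ S}

/-- The union of the two matchings given by `σ` and `τ`. -/
def unionGraph (σ τ : V → V) : SimpleGraph V :=
  SimpleGraph.fromRel fun v w => w = σ v ∨ w = τ v

/-- The component labels therefore survive an exchange, which makes exchanging with a fixed `ω` an
involution on pairs. -/
theorem unionGraph_mix {κ : Type*} (r : V → κ) (ω : κ → Bool) (σ τ : V → V) :
    unionGraph (mix r ω σ τ) (mix r ω τ σ) = unionGraph σ τ := by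
  have h : ∀ v w, (w = mix r ω σ τ v ∨ w = mix r ω τ σ v) ↔ (w = σ v ∨ w = τ v) := by
    intro v w
    by_cases h : ω (r v) = true <;> simp [mix, h, or_comm]
  simp only [unionGraph, h]

theorem unionGraph_comm (σ τ : V → V) : unionGraph σ τ = unionGraph τ σ := by
  simp only [unionGraph, or_comm]

theorem mem_movedSymmDiff_mix {κ : Type*} (S : Set V) (r : V → κ) (ω : κ → Bool) (σ τ : V → V)
    (v : V) : v ∈ movedSymmDiff S (mix r ω σ τ) ↔
      v ∈ movedSymmDiff S (if ω (r v) then σ else τ) := by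
  by_cases h : ω (r v) = true <;> simp [movedSymmDiff, mix, h]

variable [Fintype V]

/-- The index of a representative of the connected component of `v` in `H`. -/
noncomputable def componentLabel (H : SimpleGraph V) (v : V) : Fin (Fintype.card V) :=
  Fintype.equivFin V (H.connectedComponentMk v).out

theorem componentLabel_eq_iff {H : SimpleGraph V} {v w : V} :
    componentLabel H v = componentLabel H w ↔
      H.connectedComponentMk v = H.connectedComponentMk w := by
  unfold componentLabel
  rw [EmbeddingLike.apply_eq_iff_eq]
  exact ⟨fun h => (Quot.out_eq (H.connectedComponentMk v)).symm.trans
    ((congrArg H.connectedComponentMk h).trans (Quot.out_eq _)), congrArg _⟩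

theorem componentLabel_left (σ τ : V → V) (v : V) :
    componentLabel (unionGraph σ τ) (σ v) = componentLabel (unionGraph σ τ) v := by
  rw [componentLabel_eq_iff]
  by_cases h : σ v = v
  · rw [h]
  · exact SimpleGraph.ConnectedComponent.sound
      (SimpleGraph.Adj.reachable (by simp [unionGraph, h]))

theorem componentLabel_right (σ τ : V → V) (v : V) :
    componentLabel (unionGraph σ τ) (τ v) = componentLabel (unionGraph σ τ) v := by
  rw [componentLabel_eq_iff]
  by_cases h : τ v = v
  · rw [h]
  · exact SimpleGraph.ConnectedComponent.sound
      (SimpleGraph.Adj.reachable (by simp [unionGraph, h]))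

variable [DecidableEq V]

/-- A matching involution that moves as many vertices as possible. -/
structure IsMaximumInvolution (G : SimpleGraph V) (σ : V → V) : Prop
    extends IsMatchingInvolution G σ where
  card_le : ∀ τ, IsMatchingInvolution G τ → #{v | τ v ≠ v} ≤ #{v | σ v ≠ v}

theorem card_moved_mix_add {κ : Type*} (r : V → κ) (ω : κ → Bool) (σ τ : V → V) :
    #{v | mix r ω σ τ v ≠ v} + #{v | mix r ω τ σ v ≠ v} =
      #{v | σ v ≠ v} + #{v | τ v ≠ v} := by
  simp only [card_filter, ← sum_add_distrib]
  refine sum_congr rfl fun v _ => ?_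
  by_cases h : ω (r v) = true <;> simp [mix, h, add_comm]

theorem IsMaximumInvolution.mix {G : SimpleGraph V} {σ τ : V → V} {κ : Type*} {r : V → κ}
    (hσ : IsMaximumInvolution G σ) (hτ : IsMaximumInvolution G τ)
    (hrσ : ∀ v, r (σ v) = r v) (hrτ : ∀ v, r (τ v) = r v) (ω : κ → Bool) :
    IsMaximumInvolution G (mix r ω σ τ) where
  toIsMatchingInvolution := hσ.toIsMatchingInvolution.mix hτ.toIsMatchingInvolution hrσ hrτ ω
  card_le ρ hρ := by
    have h1 := card_moved_mix_add r ω σ τ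
    have h2 := hσ.card_le _
      (hτ.toIsMatchingInvolution.mix hσ.toIsMatchingInvolution hrτ hrσ ω)
    have h3 := hτ.card_le ρ hρ
    omega

/-- Two maximum matchings cover equally many vertices of every component of their union. -/
theorem IsMaximumInvolution.card_moved_label_eq {G : SimpleGraph V} {σ τ : V → V} {κ : Type*}
    [DecidableEq κ] {r : V → κ}
    (hσ : IsMaximumInvolution G σ) (hτ : IsMaximumInvolution G τ)
    (hrσ : ∀ v, r (σ v) = r v) (hrτ : ∀ v, r (τ v) = r v) (k : κ) :
    #{v | r v = k ∧ σ v ≠ v} = #{v | r v = k ∧ τ v ≠ v} := by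
  -- Replace `σ` by `τ` on the class `k` alone; both matchings being maximum, the number of covered
  -- vertices cannot change.
  have hm := hσ.mix hτ hrσ hrτ fun j => decide (j ≠ k)
  have h := (hm.card_le σ hσ.1).antisymm (hσ.card_le _ hm.1)
  have e : #{v | BKMatching.mix r (fun j => decide (j ≠ k)) σ τ v ≠ v} +
      #{v | r v = k ∧ σ v ≠ v} = #{v | σ v ≠ v} + #{v | r v = k ∧ τ v ≠ v} := by
    simp only [card_filter, ← sum_add_distrib]
    refine sum_congr rfl fun v _ => ?_
    by_cases h : r v = k <;> simp [BKMatching.mix, h, add_comm]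
  omega

/-- A bipartite matching covers equally many vertices on either side of a label class. -/
theorem IsMatchingInvolution.card_moved_label {G : SimpleGraph V} {σ : V → V} {κ : Type*}
    [DecidableEq κ] {r : V → κ} (hσ : IsMatchingInvolution G σ) (hrσ : ∀ v, r (σ v) = r v)
    (S : Set V) [DecidablePred (· ∈ S)] (hS : ∀ v w, G.Adj v w → (v ∈ S ↔ w ∉ S)) (k : κ) :
    #{v | r v = k ∧ σ v ≠ v} = 2 * #{v | r v = k ∧ σ v ≠ v ∧ v ∈ S} := by
  have h : #{v | r v = k ∧ σ v ≠ v ∧ v ∈ S} = #{v | r v = k ∧ σ v ≠ v ∧ v ∉ S} := by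
    refine card_nbij' σ σ ?_ ?_ (fun v _ => hσ.involutive v) (fun v _ => hσ.involutive v)
    · intro v hv
      simp only [coe_filter, mem_univ, true_and, Set.mem_ofPred_eq] at hv ⊢
      refine ⟨(hrσ v).trans hv.1, ?_, (hS _ _ (hσ.adj v hv.2.1)).mp hv.2.2⟩
      rw [hσ.involutive v]
      exact hv.2.1.symm
    · intro v hv
      simp only [coe_filter, mem_univ, true_and, Set.mem_ofPred_eq] at hv ⊢
      refine ⟨(hrσ v).trans hv.1, ?_, not_not.mp (mt (hS _ _ (hσ.adj v hv.2.1)).mpr hv.2.2)⟩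
      rw [hσ.involutive v]
      exact hv.2.1.symm
  have h' := card_filter_add_card_filter_not (s := ({v | r v = k ∧ σ v ≠ v} : Finset V))
    (fun v => v ∈ S)
  simp only [filter_filter, and_assoc] at h'
  omega

/-- Connectedness of the components of the union of two matchings, as an inequality. -/
theorem two_mul_card_component_le {σ τ : V → V} (hσ : Function.Involutive σ)
    (hτ : Function.Involutive τ) (u : V) :
    2 * #{v | componentLabel (unionGraph σ τ) v = componentLabel (unionGraph σ τ) u} ≤
      #{v | componentLabel (unionGraph σ τ) v = componentLabel (unionGraph σ τ) u ∧ σ v ≠ v} +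
      #{v | componentLabel (unionGraph σ τ) v = componentLabel (unionGraph σ τ) u ∧ τ v ≠ v} +
      2 := by
  classical
  set H := unionGraph σ τ with hH
  let C := H.connectedComponentMk u
  have hC : ∀ v, componentLabel H v = componentLabel H u ↔ v ∈ C.supp := fun v =>
    componentLabel_eq_iff.trans (C.mem_supp_iff v).symm
  have hconn : C.toSimpleGraph.Connected := C.connected_toSimpleGraph
  -- A connected graph on `n` vertices has at least `n - 1` edges; the degree sum is bounded by
  -- counting moves of `σ` and `τ`.
  have h1 := hconn.card_vert_le_card_edgeSet_add_one
  have h2 := C.toSimpleGraph.sum_degrees_eq_twice_card_edges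
  have hdeg : ∀ v : C, C.toSimpleGraph.degree v ≤
      (if σ v ≠ v then 1 else 0) + if τ v ≠ v then 1 else 0 := by
    intro v
    calc C.toSimpleGraph.degree v
        = #((C.toSimpleGraph.neighborFinset v).map (Function.Embedding.subtype _)) := by
          rw [card_map, SimpleGraph.card_neighborFinset_eq_degree]
      _ ≤ #((if σ v ≠ v then {σ v} else ∅) ∪ (if τ v ≠ v then {τ v} else ∅) : Finset V) := by
          refine card_le_card fun w hw => ?_
          simp only [mem_map, SimpleGraph.mem_neighborFinset, Function.Embedding.subtype_apply]
            at hw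
          obtain ⟨w, hvw, rfl⟩ := hw
          have hvw' : H.Adj v w := hvw
          simp only [hH, unionGraph, SimpleGraph.fromRel_adj] at hvw'
          obtain ⟨hne, h⟩ := hvw'
          have h' : (w : V) = σ v ∨ (w : V) = τ v := by
            rcases h with h | h | h
            · exact h
            · exact Or.inl (by rw [h, hσ])
            · exact Or.inr (by rw [h, hτ])
          rcases h' with h | h
          · simp [← h, hne.symm]
          · simp [← h, hne.symm]
      _ ≤ _ := by
          refine (card_union_le _ _).trans (add_le_add ?_ ?_) <;> split_ifs <;> simp
  have hsum : ∀ p : V → Prop, ∀ [DecidablePred p],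
      ∑ v : C, (if p v then 1 else 0) = #{v | componentLabel H v = componentLabel H u ∧ p v} := by
    intro p _
    rw [← filter_filter, card_filter]
    exact (sum_subtype ({v | componentLabel H v = componentLabel H u} : Finset V) (p := (· ∈ C))
      (fun v => by rw [mem_filter, hC]; exact and_iff_right (mem_univ v)) fun v => if p v then 1 else 0).symm
  have h3 := sum_le_sum fun v (_ : v ∈ (univ : Finset C)) => hdeg v
  rw [sum_add_distrib, hsum fun v => σ v ≠ v, hsum fun v => τ v ≠ v, h2] at h3
  have h4 : Nat.card C = #{v | componentLabel H v = componentLabel H u} := by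
    have := hsum fun _ => True
    simp only [and_true, if_true] at this
    rw [← this]
    simp
  rw [h4, Nat.card_eq_fintype_card, ← SimpleGraph.edgeFinset_card] at h1
  omega

/-- In a component of the union of two maximum matchings, at most one vertex is uncovered by the
first one. -/
theorem IsMaximumInvolution.eq_of_fixed {G : SimpleGraph V} {σ τ : V → V}
    (hσ : IsMaximumInvolution G σ) (hτ : IsMaximumInvolution G τ) {u v : V}
    (huv : componentLabel (unionGraph σ τ) v = componentLabel (unionGraph σ τ) u)
    (hu : σ u = u) (hv : σ v = v) : u = v := by
  have h1 := two_mul_card_component_le hσ.involutive hτ.involutive u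
  have h2 := hσ.card_moved_label_eq hτ (componentLabel_left σ τ) (componentLabel_right σ τ)
    (componentLabel (unionGraph σ τ) u)
  have h3 := card_filter_add_card_filter_not
    (s := ({v | componentLabel (unionGraph σ τ) v = componentLabel (unionGraph σ τ) u} :
      Finset V)) (fun v => σ v = v)
  rw [filter_filter, filter_filter] at h3
  -- If each matching covers `m` of the `n` vertices, then `2n ≤ 2m + 2`.
  have h4 : #{v | componentLabel (unionGraph σ τ) v = componentLabel (unionGraph σ τ) u ∧
      σ v = v} ≤ 1 := by
    simp only [ne_eq] at h1 h2
    omega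
  exact card_le_one.mp h4 u (by simp [hu]) v (by simp [huv, hv])

/-- In a component of the union of two maximum matchings of a bipartite graph, the uncovered
vertices are on the same side. -/
theorem IsMaximumInvolution.mem_of_fixed {G : SimpleGraph V} {σ τ : V → V} {S : Set V}
    (hS : ∀ v w, G.Adj v w → (v ∈ S ↔ w ∉ S))
    (hσ : IsMaximumInvolution G σ) (hτ : IsMaximumInvolution G τ) {u v : V}
    (huv : componentLabel (unionGraph σ τ) v = componentLabel (unionGraph σ τ) u)
    (hu : σ u = u) (hv : τ v = v) (huS : u ∈ S) : v ∈ S := by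
  classical
  set r := componentLabel (unionGraph σ τ) with hr
  have h1 := hσ.card_moved_label_eq hτ (componentLabel_left σ τ) (componentLabel_right σ τ) (r u)
  rw [hσ.card_moved_label (componentLabel_left σ τ) S hS,
    hτ.card_moved_label (componentLabel_right σ τ) S hS] at h1
  have split (ρ : V → V) := card_filter_add_card_filter_not
    (s := ({v | r v = r u ∧ v ∈ S} : Finset V)) (fun v => ρ v ≠ v)
  simp only [filter_filter, not_not] at split
  have e (ρ : V → V) : #{v | (r v = r u ∧ v ∈ S) ∧ ρ v ≠ v} =
      #{v | r v = r u ∧ ρ v ≠ v ∧ v ∈ S} := by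
    congr 1; ext; simp; tauto
  have h2 := split σ
  have h3 := split τ
  rw [e] at h2 h3
  have h4 : 0 < #{v | (r v = r u ∧ v ∈ S) ∧ σ v = v} := card_pos.mpr ⟨u, by simp [huS, hu]⟩
  -- Both matchings cover equally many `S`-vertices of the component, so `τ` also misses one there;
  -- by uniqueness it is `v`.
  have h5 : 0 < #{v | (r v = r u ∧ v ∈ S) ∧ τ v = v} := by
    rw [← hr] at h1
    omega
  obtain ⟨w, hw⟩ := card_pos.mp h5
  simp only [mem_filter, mem_univ, true_and] at hw
  have hvw : v = w := by
    refine hτ.eq_of_fixed hσ ?_ hv hw.2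
    rw [unionGraph_comm τ σ, ← hr, hw.1.1, huv]
  exact hvw ▸ hw.1.2

/-- A component of the union of two maximum matchings of a bipartite graph has at most one vertex
that belongs to `V(M) ∆ S` for the first matching but not for the second one. -/
theorem IsMaximumInvolution.eq_of_mem_movedSymmDiff {G : SimpleGraph V} {σ τ : V → V} {S : Set V}
    (hS : ∀ v w, G.Adj v w → (v ∈ S ↔ w ∉ S))
    (hσ : IsMaximumInvolution G σ) (hτ : IsMaximumInvolution G τ) {u v : V}
    (huv : componentLabel (unionGraph σ τ) v = componentLabel (unionGraph σ τ) u)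
    (hu : u ∈ movedSymmDiff S σ) (hu' : u ∉ movedSymmDiff S τ)
    (hv : v ∈ movedSymmDiff S σ) (hv' : v ∉ movedSymmDiff S τ) : u = v := by
  simp only [movedSymmDiff, Set.mem_ofPred_eq] at hu hu' hv hv'
  -- On `S`, the hypotheses mean missed by `σ` and covered by `τ`; off `S`, the reverse.
  by_cases huS : u ∈ S <;> by_cases hvS : v ∈ S <;> simp only [huS, hvS, iff_true, iff_false,
    not_not] at hu hu' hv hv'
  · exact hσ.eq_of_fixed hτ huv hu hv
  · exact absurd (hσ.mem_of_fixed hS hτ huv hu hv' huS) hvS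
  · exact absurd (hσ.mem_of_fixed hS hτ huv.symm hv hu' hvS) huS
  · exact hτ.eq_of_fixed hσ (by rwa [unionGraph_comm τ σ]) hu' hv'

/-- Exchanging two maximum matchings on the components of their union: the disjoint occurrence of
`𝒜` and `ℬ` for the first matching is at most as frequent as the joint occurrence of `𝒜` for the
first and `ℬ` for the second. -/
theorem IsMaximumInvolution.card_mix_le {G : SimpleGraph V} {σ τ : V → V} {S : Set V}
    (hS : ∀ v w, G.Adj v w → (v ∈ S ↔ w ∉ S))
    (hσ : IsMaximumInvolution G σ) (hτ : IsMaximumInvolution G τ) {𝒜 ℬ : Set (Set V)}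
    (h𝒜 : IsUpperSet 𝒜) (hℬ : IsUpperSet ℬ) [DecidablePred (· ∈ 𝒜)] [DecidablePred (· ∈ ℬ)]
    [DecidablePred (· ∈ disjointOccurrence 𝒜 ℬ)] :
    #{ω | movedSymmDiff S (BKMatching.mix (componentLabel (unionGraph σ τ)) ω σ τ) ∈
        disjointOccurrence 𝒜 ℬ} ≤
      #{ω | movedSymmDiff S (BKMatching.mix (componentLabel (unionGraph σ τ)) ω σ τ) ∈ 𝒜 ∧
        movedSymmDiff S (BKMatching.mix (componentLabel (unionGraph σ τ)) ω τ σ) ∈ ℬ} := by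
  set r := componentLabel (unionGraph σ τ) with hr
  have main := reimer (fun ω => movedSymmDiff S (BKMatching.mix r ω σ τ) ∈ 𝒜)
    (fun ω => movedSymmDiff S (BKMatching.mix r ω σ τ) ∈ ℬ)
    (fun ω => movedSymmDiff S (BKMatching.mix r ω σ τ) ∈ disjointOccurrence 𝒜 ℬ) ?_
  · simp only [mix_not] at main
    convert main
  rintro ω ⟨A, hA, B, hB, hAB, hω⟩
  -- Only vertices of `D` are affected by `ω`, so the labels of `A ∩ D` and `B ∩ D` serve as
  -- witnesses.
  let D : Set V := {v | ¬(v ∈ movedSymmDiff S σ ↔ v ∈ movedSymmDiff S τ)}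
  have cyl : ∀ E : Set V, E ⊆ movedSymmDiff S (BKMatching.mix r ω σ τ) → ∀ ω',
      (∀ k ∈ r '' (E ∩ D), ω' k = ω k) → E ⊆ movedSymmDiff S (BKMatching.mix r ω' σ τ) := by
    intro E hE ω' hω' v hv
    have hv' := hE hv
    rw [mem_movedSymmDiff_mix] at hv' ⊢
    by_cases hD : v ∈ D
    · rwa [hω' (r v) ⟨v, ⟨hv, hD⟩, rfl⟩]
    · have hD' : v ∈ movedSymmDiff S σ ↔ v ∈ movedSymmDiff S τ := not_not.mp hD
      split_ifs at hv' ⊢ <;> tauto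
  have hAsub : A ⊆ movedSymmDiff S (BKMatching.mix r ω σ τ) := hω ▸ Set.subset_union_left
  have hBsub : B ⊆ movedSymmDiff S (BKMatching.mix r ω σ τ) := hω ▸ Set.subset_union_right
  refine ⟨r '' (A ∩ D), r '' (B ∩ D), ?_, fun ω' h => h𝒜 (cyl A hAsub ω' h) hA,
    fun ω' h => hℬ (cyl B hBsub ω' h) hB⟩
  rw [Set.disjoint_left]
  rintro _ ⟨u, ⟨huA, huD⟩, rfl⟩ ⟨v, ⟨hvB, hvD⟩, hvu⟩
  have hu := hAsub huA
  have hv := hBsub hvB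
  rw [mem_movedSymmDiff_mix] at hu hv
  rw [hvu] at hv
  simp only [D, Set.mem_ofPred_eq] at huD hvD
  have huv : u = v := by
    by_cases h : ω (r u) = true
    · simp only [h, if_true] at hu hv
      exact hσ.eq_of_mem_movedSymmDiff hS hτ hvu hu (by tauto) hv (by tauto)
    · simp only [h] at hu hv
      exact hτ.eq_of_mem_movedSymmDiff hS hσ (by rwa [unionGraph_comm τ σ]) hu (by tauto) hv
        (by tauto)
  exact Set.eq_empty_iff_forall_notMem.mp hAB u ⟨huA, huv ▸ hvB⟩

/-- The BK inequality for maximum matching involutions, in terms of cardinalities. -/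
theorem card_disjointOccurrence_mul_card_le {G : SimpleGraph V} {S : Set V}
    (hS : ∀ v w, G.Adj v w → (v ∈ S ↔ w ∉ S)) {𝒜 ℬ : Set (Set V)}
    (h𝒜 : IsUpperSet 𝒜) (hℬ : IsUpperSet ℬ) (X : Finset (V → V))
    (hX : ∀ σ, σ ∈ X ↔ IsMaximumInvolution G σ)
    [DecidablePred (· ∈ 𝒜)] [DecidablePred (· ∈ ℬ)]
    [DecidablePred (· ∈ disjointOccurrence 𝒜 ℬ)] :
    #{σ ∈ X | movedSymmDiff S σ ∈ disjointOccurrence 𝒜 ℬ} * #X ≤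
      #{σ ∈ X | movedSymmDiff S σ ∈ 𝒜} * #{σ ∈ X | movedSymmDiff S σ ∈ ℬ} := by
  -- Labels belonging to no component act trivially, so one cube serves all pairs and the sums over
  -- `ω` and over pairs can be interchanged.
  let flip (ω : Fin (Fintype.card V) → Bool) (p : (V → V) × (V → V)) : (V → V) × (V → V) :=
    (mix (componentLabel (unionGraph p.1 p.2)) ω p.1 p.2,
      mix (componentLabel (unionGraph p.1 p.2)) ω p.2 p.1)
  have flip_mem : ∀ ω, ∀ p ∈ X ×ˢ X, flip ω p ∈ X ×ˢ X := by
    intro ω p hp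
    simp only [mem_product, hX] at hp ⊢
    exact ⟨hp.1.mix hp.2 (componentLabel_left _ _) (componentLabel_right _ _) ω,
      hp.2.mix hp.1 (componentLabel_right _ _) (componentLabel_left _ _) ω⟩
  have flip_flip : ∀ ω p, flip ω (flip ω p) = p := by
    intro ω p
    simp only [flip, unionGraph_mix, mix_mix]
  have sum_flip : ∀ (f : (V → V) × (V → V) → ℕ),
      ∑ p ∈ X ×ˢ X, ∑ ω, f (flip ω p) =
        Fintype.card (Fin (Fintype.card V) → Bool) * ∑ p ∈ X ×ˢ X, f p := by
    intro f
    rw [sum_comm, ← smul_eq_mul, ← Finset.card_univ (α := Fin (Fintype.card V) → Bool), ← sum_const]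
    exact sum_congr rfl fun ω _ => sum_nbij' (flip ω) (flip ω) (flip_mem ω) (flip_mem ω)
      (fun p _ => flip_flip ω p) (fun p _ => flip_flip ω p) fun p _ => rfl
  let f (p : (V → V) × (V → V)) : ℕ :=
    if movedSymmDiff S p.1 ∈ disjointOccurrence 𝒜 ℬ then 1 else 0
  let g (p : (V → V) × (V → V)) : ℕ :=
    if movedSymmDiff S p.1 ∈ 𝒜 ∧ movedSymmDiff S p.2 ∈ ℬ then 1 else 0
  have hfg : ∑ p ∈ X ×ˢ X, f p ≤ ∑ p ∈ X ×ˢ X, g p := by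
    refine Nat.le_of_mul_le_mul_left ?_
      (Fintype.card_pos (α := Fin (Fintype.card V) → Bool))
    rw [← sum_flip, ← sum_flip]
    refine sum_le_sum fun p hp => ?_
    simp only [mem_product, hX] at hp
    simp only [f, g, ← card_filter]
    exact hp.1.card_mix_le hS hp.2 h𝒜 hℬ
  have hf : ∑ p ∈ X ×ˢ X, f p = #{σ ∈ X | movedSymmDiff S σ ∈ disjointOccurrence 𝒜 ℬ} * #X := by
    simp only [f, ← card_filter]
    rw [← card_product,
      filter_product_left fun σ => movedSymmDiff S σ ∈ disjointOccurrence 𝒜 ℬ]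
  have hg : ∑ p ∈ X ×ˢ X, g p =
      #{σ ∈ X | movedSymmDiff S σ ∈ 𝒜} * #{σ ∈ X | movedSymmDiff S σ ∈ ℬ} := by
    simp only [g, ← card_filter]
    rw [← card_product, filter_product (fun σ => movedSymmDiff S σ ∈ 𝒜)
      fun σ => movedSymmDiff S σ ∈ ℬ]
  rwa [hf, hg] at hfg

end Involutions

/-! ### From subgraphs to involutions -/

section Subgraphs

variable {V : Type*} {G : SimpleGraph V}

/-- The matching given by an involution. -/
def IsMatchingInvolution.toSubgraph {σ : V → V} (hσ : IsMatchingInvolution G σ) : G.Subgraph where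
  verts := {v | σ v ≠ v}
  Adj v w := σ v ≠ v ∧ σ v = w
  adj_sub := by
    rintro v w ⟨hv, rfl⟩
    exact hσ.adj v hv
  edge_vert h := h.1
  symm := ⟨by
    rintro v w ⟨hv, rfl⟩
    refine ⟨?_, hσ.involutive v⟩
    rw [hσ.involutive v]
    exact hv.symm⟩

theorem IsMatchingInvolution.isMatching_toSubgraph {σ : V → V} (hσ : IsMatchingInvolution G σ) :
    hσ.toSubgraph.IsMatching :=
  fun v hv => ⟨σ v, ⟨hv, rfl⟩, fun _ hw => hw.2.symm⟩

open Classical in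
/-- The map that exchanges the endpoints of the edges of a matching. -/
noncomputable def partner (M : G.Subgraph) (v : V) : V :=
  if h : ∃ w, M.Adj v w then h.choose else v

theorem partner_eq_of_adj {M : G.Subgraph} (hM : M.IsMatching) {v w : V} (h : M.Adj v w) :
    partner M v = w := by
  have hex : ∃ w, M.Adj v w := ⟨w, h⟩
  rw [partner, dif_pos hex]
  exact (hM (M.edge_vert h)).unique hex.choose_spec h

theorem partner_eq_self {M : G.Subgraph} {v : V} (h : v ∉ M.verts) : partner M v = v :=
  dif_neg fun ⟨_, hw⟩ => h (M.edge_vert hw)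

theorem adj_partner {M : G.Subgraph} (hM : M.IsMatching) {v : V} (h : v ∈ M.verts) :
    M.Adj v (partner M v) := by
  obtain ⟨w, hw, -⟩ := hM h
  rwa [partner_eq_of_adj hM hw]

theorem partner_ne_self_iff {M : G.Subgraph} (hM : M.IsMatching) {v : V} :
    partner M v ≠ v ↔ v ∈ M.verts :=
  ⟨fun h => by_contra fun hv => h (partner_eq_self hv), fun h => (M.adj_sub (adj_partner hM h)).ne'⟩

theorem isMatchingInvolution_partner {M : G.Subgraph} (hM : M.IsMatching) :
    IsMatchingInvolution G (partner M) where
  involutive v := by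
    by_cases h : v ∈ M.verts
    · exact partner_eq_of_adj hM (adj_partner hM h).symm
    · rw [partner_eq_self h, partner_eq_self h]
  adj v hv := M.adj_sub (adj_partner hM ((partner_ne_self_iff hM).mp hv))

theorem partner_toSubgraph {σ : V → V} (hσ : IsMatchingInvolution G σ) :
    partner hσ.toSubgraph = σ := by
  funext v
  by_cases h : σ v = v
  · rw [h]
    exact partner_eq_self fun hv => hv h
  · exact partner_eq_of_adj hσ.isMatching_toSubgraph ⟨h, rfl⟩

theorem toSubgraph_partner {M : G.Subgraph} (hM : M.IsMatching) :
    (isMatchingInvolution_partner hM).toSubgraph = M := by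
  ext v w
  · exact partner_ne_self_iff hM
  · constructor
    · rintro ⟨hv, rfl⟩
      exact adj_partner hM ((partner_ne_self_iff hM).mp hv)
    · intro h
      exact ⟨(partner_ne_self_iff hM).mpr (M.edge_vert h), partner_eq_of_adj hM h⟩

theorem movedSymmDiff_partner (S : Set V) {M : G.Subgraph} (hM : M.IsMatching) :
    movedSymmDiff S (partner M) = coveredSymmDiff S M := by
  ext v
  have := partner_ne_self_iff hM (v := v)
  simp only [movedSymmDiff, coveredSymmDiff, Set.mem_ofPred_eq, Set.mem_symmDiff]
  tauto

variable [Fintype V] [DecidableEq V]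

/-- Handshake count: maximality in edges and in moved vertices agree. -/
theorem two_mul_ncard_edgeSet {M : G.Subgraph} (hM : M.IsMatching) :
    2 * M.edgeSet.ncard = #{v | partner M v ≠ v} := by
  classical
  rw [← SimpleGraph.Subgraph.edgeSet_spanningCoe, Set.ncard_eq_toFinset_card', card_filter]
  refine (M.spanningCoe.sum_degrees_eq_twice_card_edges).symm.trans (sum_congr rfl fun v _ => ?_)
  rw [SimpleGraph.Subgraph.degree_spanningCoe]
  by_cases hv : v ∈ M.verts
  · rw [if_pos ((partner_ne_self_iff hM).mpr hv),
      SimpleGraph.Subgraph.isMatching_iff_forall_degree.mp hM v hv]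
  · rw [if_neg (mt (partner_ne_self_iff hM).mp hv),
      SimpleGraph.Subgraph.degree_of_notMem_verts hv]

theorem isMaximumInvolution_partner {M : G.Subgraph} (hM : M ∈ maximumMatchings G) :
    IsMaximumInvolution G (partner M) where
  toIsMatchingInvolution := isMatchingInvolution_partner hM.1
  card_le τ hτ := by
    have h := hM.2 _ hτ.isMatching_toSubgraph
    have h1 := two_mul_ncard_edgeSet hτ.isMatching_toSubgraph
    rw [partner_toSubgraph hτ] at h1
    have h2 := two_mul_ncard_edgeSet hM.1
    omega

theorem IsMaximumInvolution.toSubgraph_mem {σ : V → V} (hσ : IsMaximumInvolution G σ) :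
    hσ.toSubgraph ∈ maximumMatchings G := by
  refine ⟨hσ.isMatching_toSubgraph, fun N hN => ?_⟩
  have h := hσ.card_le _ (isMatchingInvolution_partner hN)
  have h1 := two_mul_ncard_edgeSet hσ.isMatching_toSubgraph
  rw [partner_toSubgraph] at h1
  have h2 := two_mul_ncard_edgeSet hN
  omega

/-- Counting maximum matchings by means of involutions. -/
theorem card_maximumMatchings_filter (S : Set V) (X : Finset G.Subgraph) (Y : Finset (V → V))
    (hX : ∀ M, M ∈ X ↔ M ∈ maximumMatchings G) (hY : ∀ σ, σ ∈ Y ↔ IsMaximumInvolution G σ)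
    (𝒞 : Set (Set V)) [DecidablePred (coveredSymmDiff S · ∈ 𝒞 : G.Subgraph → Prop)]
    [DecidablePred (· ∈ 𝒞)] :
    #{M ∈ X | coveredSymmDiff S M ∈ 𝒞} = #{σ ∈ Y | movedSymmDiff S σ ∈ 𝒞} := by
  refine card_bij (fun M _ => partner M) ?_ ?_ ?_
  · intro M hM
    rw [mem_filter, hX] at hM
    rw [mem_filter, hY, movedSymmDiff_partner S hM.1.1]
    exact ⟨isMaximumInvolution_partner hM.1, hM.2⟩
  · intro M hM N hN h
    rw [mem_filter, hX] at hM hN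
    rw [← toSubgraph_partner hM.1.1, ← toSubgraph_partner hN.1.1]
    congr 1
  · intro σ hσ
    rw [mem_filter, hY] at hσ
    refine ⟨hσ.1.toSubgraph, ?_, partner_toSubgraph _⟩
    rw [mem_filter, hX, ← movedSymmDiff_partner S hσ.1.isMatching_toSubgraph,
      partner_toSubgraph]
    exact ⟨hσ.1.toSubgraph_mem, hσ.2⟩

end Subgraphs

/-! ### From counts to probabilities -/

theorem uniformMaximumMatching_toOuterMeasure_map {V : Type*} [Fintype V] [DecidableEq V]
    (G : SimpleGraph V) (S : Set V) (Y : Finset (V → V))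
    (hY : ∀ σ, σ ∈ Y ↔ IsMaximumInvolution G σ) (𝒞 : Set (Set V)) [DecidablePred (· ∈ 𝒞)] :
    ((uniformMaximumMatching G).map (coveredSymmDiff S)).toOuterMeasure 𝒞 =
      (#{σ ∈ Y | movedSymmDiff S σ ∈ 𝒞} : ENNReal) / #Y := by
  classical
  rw [PMF.toOuterMeasure_map_apply, uniformMaximumMatching,
    PMF.toOuterMeasure_uniformOfFinset_apply]
  have hX : ∀ M, M ∈ (Set.toFinite (maximumMatchings G)).toFinset ↔ M ∈ maximumMatchings G :=
    fun M => Set.Finite.mem_toFinset _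
  have h1 := card_maximumMatchings_filter S _ Y hX hY 𝒞
  have h2 := card_maximumMatchings_filter S _ Y hX hY Set.univ
  simp only [Set.mem_univ, filter_true] at h2
  rw [← h1, ← h2]
  congr!

end BKMatching

theorem theorem4 {V : Type*} [Finite V] (G : SimpleGraph V) (S T : Set V)
    (hG : G.IsBipartiteWith S T) (hV : S ∪ T = Set.univ) :
    BKMatching.SatisfiesBKIncreasing
      ((BKMatching.uniformMaximumMatching G).map (BKMatching.coveredSymmDiff S)) := by
  classical
  have := Fintype.ofFinite V
  intro 𝒜 ℬ h𝒜 hℬ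
  have hS : ∀ v w, G.Adj v w → (v ∈ S ↔ w ∉ S) := by
    intro v w h
    have hd := Set.disjoint_left.mp hG.disjoint
    rcases hG.mem_of_adj h with ⟨hv, hw⟩ | ⟨hv, hw⟩
    · exact ⟨fun _ h => hd h hw, fun _ => hv⟩
    · exact ⟨fun h => absurd hv (hd h), fun h => absurd hw h⟩
  let Y : Finset (V → V) := {σ | BKMatching.IsMaximumInvolution G σ}
  have hY : ∀ σ, σ ∈ Y ↔ BKMatching.IsMaximumInvolution G σ := fun σ => by simp [Y]
  have key := BKMatching.card_disjointOccurrence_mul_card_le hS h𝒜 hℬ Y hY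
  have hpos : (Y.card : ENNReal) ≠ 0 := by
    obtain ⟨M, hM⟩ := BKMatching.maximumMatchings_nonempty G
    exact Nat.cast_ne_zero.mpr (Finset.card_ne_zero_of_mem
      ((hY _).mpr (BKMatching.isMaximumInvolution_partner hM)))
  simp only [BKMatching.uniformMaximumMatching_toOuterMeasure_map G S Y hY]
  have htop := ENNReal.natCast_ne_top Y.card
  rw [← ENNReal.mul_div_mul_right _ _ hpos htop,
    ← ENNReal.mul_div_mul_comm (Or.inl hpos) (Or.inl htop)]
  exact ENNReal.div_le_div_right (by exact_mod_cast key) _
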